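/- Let $\mathcal{M}$ be a pointed closed symmetric monoidal model category with zero object $0$ and monoidal unit $V$. (Tensoring with a cofibrant object preserves cofibrations and trivial cofibrations, and the unit axiom holds: $QV\otimes X\to V\otimes X$ is a weak equivalence for every cofibrant $X$, where $QV\to V$ is a cofibrant replacement.) Tensor products, push-out products, kernels and cokernels below are understood homotopically, i.e. they are derived by means of cofibrant and fibrant replacements. The homotopy image $\mathrm{Im}(f)$ of a morphism $f:X\to Y$ is the homotopy kernel of $Y\to\mathrm{Coker}(f)$, where $\mathrm{Coker}(f)$ is the homotopy cokernel. An object is contractible if it is weakly equivalent to $0$. Let $j:I\to V$ be a Smith ideal, i.e. a monoid object of the arrow category $\mathrm{Ar}(\mathcal{M})$ with respect to the push-out product $\Box$, and put $\tilde I=I\otimes I$. Assume that $j$ is homotopically idempotent, i.e. 1. the homotopy coCartesian square with corners $I$, $V$, $0$, $\mathrm{Coker}(j)$ is also homotopy Cartesian; 2. the multiplication $\mu_j: j\,\Box\, j\to j$ is a (levelwise) weak equivalence in $\mathrm{Ar}(\mathcal{M})$; 3. $\tilde I$ is homotopically flat: the functor $\tilde I\otimes(-):\mathcal{M}\to\mathcal{M}$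 preserves finite homotopy limits. Then, for every object $M$ of $\mathcal{M}$, the following are equivalent: * $M$ is homotopically almost zero, i.e. the homotopy image of the composition $\mu_M: I\otimes M\xrightarrow{\,j\otimes \mathrm{id}\,} V\otimes M\cong M$ is contractible; * $\tilde I\otimes M$ is contractible. -/

import Mathlib

open CategoryTheory Limits MonoidalCategory HomotopicalAlgebra

universe v u

namespace AlmostMath

/-! ### The push-out product monoidal structure on the arrow category

For a closed symmetric monoidal category `C` with push-outs and an initial object, we construct
the monoidal structure on `Arrow C` whose tensor product is the push-out product
`f □ g : (X₁ ⊗ Y₀) ⨿_{X₀ ⊗ Y₀} (X₀ ⊗ Y₁) ⟶ X₁ ⊗ Y₁` and whose unit is `∅ ⟶ 𝟙_ C`. -/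

section Tensor
variable {C : Type u} [Category.{v} C] [MonoidalCategory C]

theorem comp_tensorHom_eq {A B D E F : C} (p : A ⟶ B) (q : B ⟶ D) (c : E ⟶ F) :
    (p ≫ q) ⊗ₘ c = (p ⊗ₘ c) ≫ q ▷ F := by
  rw [← tensorHom_id, tensorHom_comp_tensorHom, Category.comp_id]

theorem tensorHom_comp_eq {A B D E F : C} (p : A ⟶ B) (q : B ⟶ D) (c : E ⟶ F) :
    c ⊗ₘ (p ≫ q) = (c ⊗ₘ p) ≫ F ◁ q := by
  rw [← id_tensorHom, tensorHom_comp_tensorHom, Category.comp_id]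

theorem whiskerRight_comp_tensorHom {A B D E F : C} (p : A ⟶ B) (q : B ⟶ D) (c : E ⟶ F) :
    p ▷ E ≫ (q ⊗ₘ c) = (p ≫ q) ⊗ₘ c := by
  rw [← tensorHom_id, tensorHom_comp_tensorHom, Category.id_comp]

theorem whiskerLeft_comp_tensorHom {A B D E F : C} (p : A ⟶ B) (q : B ⟶ D) (c : E ⟶ F) :
    E ◁ p ≫ (c ⊗ₘ q) = c ⊗ₘ (p ≫ q) := by
  rw [← id_tensorHom, tensorHom_comp_tensorHom, Category.id_comp]

theorem whiskerRight_comp_tensorHom_assoc {A B D E F T : C} (p : A ⟶ B) (q : B ⟶ D) (c : E ⟶ F)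
    (t : D ⊗ F ⟶ T) : p ▷ E ≫ (q ⊗ₘ c) ≫ t = ((p ≫ q) ⊗ₘ c) ≫ t := by
  rw [← Category.assoc, whiskerRight_comp_tensorHom]

theorem whiskerLeft_comp_tensorHom_assoc {A B D E F T : C} (p : A ⟶ B) (q : B ⟶ D) (c : E ⟶ F)
    (t : F ⊗ D ⟶ T) : E ◁ p ≫ (c ⊗ₘ q) ≫ t = (c ⊗ₘ (p ≫ q)) ≫ t := by
  rw [← Category.assoc, whiskerLeft_comp_tensorHom]

end Tensor

section PushoutProduct
variable {C : Type u} [Category.{v} C] [MonoidalCategory C] [HasPushouts C]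
variable {X₀ X₁ Y₀ Y₁ Z₀ Z₁ W₀ W₁ : C}

/-- The domain `(X₁ ⊗ Y₀) ⨿_{X₀ ⊗ Y₀} (X₀ ⊗ Y₁)` of the push-out product `f □ g`. -/
noncomputable def boxDom (f : X₀ ⟶ X₁) (g : Y₀ ⟶ Y₁) : C := pushout (f ▷ Y₀) (X₀ ◁ g)

noncomputable def boxInl (f : X₀ ⟶ X₁) (g : Y₀ ⟶ Y₁) : X₁ ⊗ Y₀ ⟶ boxDom f g := pushout.inl _ _

noncomputable def boxInr (f : X₀ ⟶ X₁) (g : Y₀ ⟶ Y₁) : X₀ ⊗ Y₁ ⟶ boxDom f g := pushout.inr _ _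

theorem box_isPushout (f : X₀ ⟶ X₁) (g : Y₀ ⟶ Y₁) :
    IsPushout (f ▷ Y₀) (X₀ ◁ g) (boxInl f g) (boxInr f g) :=
  IsPushout.of_hasPushout _ _

theorem box_condition (f : X₀ ⟶ X₁) (g : Y₀ ⟶ Y₁) :
    f ▷ Y₀ ≫ boxInl f g = X₀ ◁ g ≫ boxInr f g := (box_isPushout f g).w

theorem box_condition_assoc (f : X₀ ⟶ X₁) (g : Y₀ ⟶ Y₁) {U : C} (t : boxDom f g ⟶ U) :
    f ▷ Y₀ ≫ boxInl f g ≫ t =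
      X₀ ◁ g ≫ boxInr f g ≫ t := by
  rw [← Category.assoc, box_condition]
  simp only [Category.assoc]

section desc
variable {f : X₀ ⟶ X₁} {g : Y₀ ⟶ Y₁}  {T : C} (a : X₁ ⊗ Y₀ ⟶ T) (b : X₀ ⊗ Y₁ ⟶ T)
    (h : f ▷ Y₀ ≫ a = X₀ ◁ g ≫ b)

noncomputable def boxDesc : boxDom f g ⟶ T := (box_isPushout f g).desc a b h

@[simp]
theorem boxInl_desc : boxInl f g ≫ boxDesc a b h = a := (box_isPushout f g).inl_desc _ _ _

@[simp]
theorem boxInl_desc_assoc {U : C} (t : T ⟶ U) :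
    boxInl f g ≫ boxDesc a b h ≫ t =
      a ≫ t := by
  rw [← Category.assoc, boxInl_desc]

@[simp]
theorem boxInr_desc : boxInr f g ≫ boxDesc a b h = b := (box_isPushout f g).inr_desc _ _ _

@[simp]
theorem boxInr_desc_assoc {U : C} (t : T ⟶ U) :
    boxInr f g ≫ boxDesc a b h ≫ t =
      b ≫ t := by
  rw [← Category.assoc, boxInr_desc]

theorem boxDom_hom_ext {a b : boxDom f g ⟶ T}
    (h1 : boxInl f g ≫ a = boxInl f g ≫ b) (h2 : boxInr f g ≫ a = boxInr f g ≫ b) : a = b :=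
  (box_isPushout f g).hom_ext h1 h2
end desc

/-- The push-out product `f □ g`. -/
noncomputable def box (f : X₀ ⟶ X₁) (g : Y₀ ⟶ Y₁) : boxDom f g ⟶ X₁ ⊗ Y₁ :=
  boxDesc (X₁ ◁ g) (f ▷ Y₁) (whisker_exchange _ _).symm

@[simp]
theorem boxInl_box (f : X₀ ⟶ X₁) (g : Y₀ ⟶ Y₁) : boxInl f g ≫ box f g = X₁ ◁ g :=
  boxInl_desc _ _ _

@[simp]
theorem boxInl_box_assoc (f : X₀ ⟶ X₁) (g : Y₀ ⟶ Y₁) {U : C} (t : X₁ ⊗ Y₁ ⟶ U) :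
    boxInl f g ≫ box f g ≫ t =
      X₁ ◁ g ≫ t := by
  rw [← Category.assoc, boxInl_box]

@[simp]
theorem boxInr_box (f : X₀ ⟶ X₁) (g : Y₀ ⟶ Y₁) : boxInr f g ≫ box f g = f ▷ Y₁ :=
  boxInr_desc _ _ _

@[simp]
theorem boxInr_box_assoc (f : X₀ ⟶ X₁) (g : Y₀ ⟶ Y₁) {U : C} (t : X₁ ⊗ Y₁ ⟶ U) :
    boxInr f g ≫ box f g ≫ t =
      f ▷ Y₁ ≫ t := by
  rw [← Category.assoc, boxInr_box]

section map
variable {X₀' X₁' Y₀' Y₁' : C} {f : X₀ ⟶ X₁} {g : Y₀ ⟶ Y₁} {f' : X₀' ⟶ X₁'} {g' : Y₀' ⟶ Y₁'}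
  (a₀ : X₀ ⟶ X₀') (a₁ : X₁ ⟶ X₁') (b₀ : Y₀ ⟶ Y₀') (b₁ : Y₁ ⟶ Y₁')
  (ha : a₀ ≫ f' = f ≫ a₁) (hb : b₀ ≫ g' = g ≫ b₁)

noncomputable def boxDomMap : boxDom f g ⟶ boxDom f' g' :=
  boxDesc ((a₁ ⊗ₘ b₀) ≫ boxInl f' g') ((a₀ ⊗ₘ b₁) ≫ boxInr f' g') (by
    have h1 : f ▷ Y₀ ≫ (a₁ ⊗ₘ b₀) = (a₀ ⊗ₘ b₀) ≫ f' ▷ Y₀' := by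
      simp only [← tensorHom_id, ← id_tensorHom, tensorHom_comp_tensorHom, ha, Category.id_comp,
        Category.comp_id]
    have h2 : X₀ ◁ g ≫ (a₀ ⊗ₘ b₁) = (a₀ ⊗ₘ b₀) ≫ X₀' ◁ g' := by
      simp only [← tensorHom_id, ← id_tensorHom, tensorHom_comp_tensorHom, hb, Category.id_comp,
        Category.comp_id]
    rw [← Category.assoc, ← Category.assoc, h1, h2, Category.assoc, Category.assoc, box_condition])

@[simp]
theorem boxInl_map : boxInl f g ≫ boxDomMap a₀ a₁ b₀ b₁ ha hb = (a₁ ⊗ₘ b₀) ≫ boxInl f' g' :=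
  boxInl_desc _ _ _

@[simp]
theorem boxInl_map_assoc {U : C} (t : boxDom f' g' ⟶ U) :
    boxInl f g ≫ boxDomMap a₀ a₁ b₀ b₁ ha hb ≫ t =
      (a₁ ⊗ₘ b₀) ≫ boxInl f' g' ≫ t := by
  rw [← Category.assoc, boxInl_map]
  simp only [Category.assoc]

@[simp]
theorem boxInr_map : boxInr f g ≫ boxDomMap a₀ a₁ b₀ b₁ ha hb = (a₀ ⊗ₘ b₁) ≫ boxInr f' g' :=
  boxInr_desc _ _ _

@[simp]
theorem boxInr_map_assoc {U : C} (t : boxDom f' g' ⟶ U) :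
    boxInr f g ≫ boxDomMap a₀ a₁ b₀ b₁ ha hb ≫ t =
      (a₀ ⊗ₘ b₁) ≫ boxInr f' g' ≫ t := by
  rw [← Category.assoc, boxInr_map]
  simp only [Category.assoc]

theorem boxDomMap_box :
    boxDomMap a₀ a₁ b₀ b₁ ha hb ≫ box f' g' = box f g ≫ (a₁ ⊗ₘ b₁) := by
  apply boxDom_hom_ext
  · simp only [boxInl_map_assoc, boxInl_box, boxInl_box_assoc, ← id_tensorHom,
      tensorHom_comp_tensorHom, hb, Category.id_comp, Category.comp_id]
  · simp only [boxInr_map_assoc, boxInr_box, boxInr_box_assoc, ← tensorHom_id,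
      tensorHom_comp_tensorHom, ha, Category.id_comp, Category.comp_id]

theorem boxDomMap_box_assoc {U : C} (t : X₁' ⊗ Y₁' ⟶ U) :
    boxDomMap a₀ a₁ b₀ b₁ ha hb ≫ box f' g' ≫ t =
      box f g ≫ (a₁ ⊗ₘ b₁) ≫ t := by
  rw [← Category.assoc, boxDomMap_box]
  simp only [Category.assoc]
end map

section whisker
variable [BraidedCategory C] [MonoidalClosed C] (f : X₀ ⟶ X₁) (g : Y₀ ⟶ Y₁) (W : C)

theorem box_isPushout_whiskerLeft :
    IsPushout (W ◁ f ▷ Y₀) (W ◁ X₀ ◁ g) (W ◁ boxInl f g) (W ◁ boxInr f g) :=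
  (tensorLeft W).map_isPushout (box_isPushout f g)

theorem box_isPushout_whiskerRight :
    IsPushout ((f ▷ Y₀) ▷ W) ((X₀ ◁ g) ▷ W) (boxInl f g ▷ W) (boxInr f g ▷ W) :=
  (tensorRight W).map_isPushout (box_isPushout f g)

variable {f g W} {T : C}

theorem whiskerLeft_boxDom_hom_ext {a b : W ⊗ boxDom f g ⟶ T}
    (h1 : W ◁ boxInl f g ≫ a = W ◁ boxInl f g ≫ b)
    (h2 : W ◁ boxInr f g ≫ a = W ◁ boxInr f g ≫ b) : a = b :=
  (box_isPushout_whiskerLeft f g W).hom_ext h1 h2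

theorem boxDom_whiskerRight_hom_ext {a b : boxDom f g ⊗ W ⟶ T}
    (h1 : boxInl f g ▷ W ≫ a = boxInl f g ▷ W ≫ b)
    (h2 : boxInr f g ▷ W ≫ a = boxInr f g ▷ W ≫ b) : a = b :=
  (box_isPushout_whiskerRight f g W).hom_ext h1 h2

theorem boxDom_whiskerRight_whiskerRight_hom_ext {W' : C} {a b : (boxDom f g ⊗ W) ⊗ W' ⟶ T}
    (h1 : (boxInl f g ▷ W) ▷ W' ≫ a = (boxInl f g ▷ W) ▷ W' ≫ b)
    (h2 : (boxInr f g ▷ W) ▷ W' ≫ a = (boxInr f g ▷ W) ▷ W' ≫ b) : a = b :=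
  ((tensorRight W').map_isPushout (box_isPushout_whiskerRight f g W)).hom_ext h1 h2
end whisker

section assoc
variable [BraidedCategory C] [MonoidalClosed C] (f : X₀ ⟶ X₁) (g : Y₀ ⟶ Y₁) (h : Z₀ ⟶ Z₁)

noncomputable def boxAssocHomAux : boxDom f g ⊗ Z₁ ⟶ boxDom f (box g h) :=
  (box_isPushout_whiskerRight f g Z₁).desc
    ((α_ _ _ _).hom ≫ X₁ ◁ boxInr g h ≫ boxInl f (box g h))
    ((α_ _ _ _).hom ≫ boxInr f (box g h))
    (by
      rw [associator_naturality_left_assoc, ← whisker_exchange_assoc, box_condition,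
        ← MonoidalCategory.whiskerLeft_comp_assoc, boxInr_box]
      simp)

@[simp]
theorem boxInl_assocHomAux : boxInl f g ▷ Z₁ ≫ boxAssocHomAux f g h =
    (α_ _ _ _).hom ≫ X₁ ◁ boxInr g h ≫ boxInl f (box g h) := IsPushout.inl_desc _ _ _ _

@[simp]
theorem boxInl_assocHomAux_assoc {U : C} (t : boxDom f (box g h) ⟶ U) :
    boxInl f g ▷ Z₁ ≫ boxAssocHomAux f g h ≫ t =
      (α_ _ _ _).hom ≫ X₁ ◁ boxInr g h ≫ boxInl f (box g h) ≫ t := by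
  rw [← Category.assoc, boxInl_assocHomAux]
  simp only [Category.assoc]

@[simp]
theorem boxInr_assocHomAux : boxInr f g ▷ Z₁ ≫ boxAssocHomAux f g h =
    (α_ _ _ _).hom ≫ boxInr f (box g h) := IsPushout.inr_desc _ _ _ _

@[simp]
theorem boxInr_assocHomAux_assoc {U : C} (t : boxDom f (box g h) ⟶ U) :
    boxInr f g ▷ Z₁ ≫ boxAssocHomAux f g h ≫ t =
      (α_ _ _ _).hom ≫ boxInr f (box g h) ≫ t := by
  rw [← Category.assoc, boxInr_assocHomAux]
  simp only [Category.assoc]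

noncomputable def boxAssocHom : boxDom (box f g) h ⟶ boxDom f (box g h) :=
  boxDesc ((α_ _ _ _).hom ≫ X₁ ◁ boxInl g h ≫ boxInl f (box g h)) (boxAssocHomAux f g h) (by
    apply boxDom_whiskerRight_hom_ext
    · rw [← whisker_exchange_assoc, boxInl_assocHomAux, ← comp_whiskerRight_assoc, boxInl_box,
        associator_naturality_middle_assoc, associator_naturality_right_assoc,
        ← MonoidalCategory.whiskerLeft_comp_assoc, ← MonoidalCategory.whiskerLeft_comp_assoc,
        box_condition]
    · rw [← whisker_exchange_assoc, boxInr_assocHomAux, ← comp_whiskerRight_assoc, boxInr_box,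
        associator_naturality_left_assoc, associator_naturality_right_assoc,
        ← whisker_exchange_assoc, box_condition,
        ← MonoidalCategory.whiskerLeft_comp_assoc, boxInl_box])

@[simp]
theorem boxInl_assocHom : boxInl (box f g) h ≫ boxAssocHom f g h =
    (α_ _ _ _).hom ≫ X₁ ◁ boxInl g h ≫ boxInl f (box g h) := boxInl_desc _ _ _

@[simp]
theorem boxInl_assocHom_assoc {U : C} (t : boxDom f (box g h) ⟶ U) :
    boxInl (box f g) h ≫ boxAssocHom f g h ≫ t =
      (α_ _ _ _).hom ≫ X₁ ◁ boxInl g h ≫ boxInl f (box g h) ≫ t := by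
  rw [← Category.assoc, boxInl_assocHom]
  simp only [Category.assoc]

@[simp]
theorem boxInr_assocHom : boxInr (box f g) h ≫ boxAssocHom f g h = boxAssocHomAux f g h :=
  boxInr_desc _ _ _

@[simp]
theorem boxInr_assocHom_assoc {U : C} (t : boxDom f (box g h) ⟶ U) :
    boxInr (box f g) h ≫ boxAssocHom f g h ≫ t =
      boxAssocHomAux f g h ≫ t := by
  rw [← Category.assoc, boxInr_assocHom]

noncomputable def boxAssocInvAux : X₁ ⊗ boxDom g h ⟶ boxDom (box f g) h :=
  (box_isPushout_whiskerLeft g h X₁).desc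
    ((α_ _ _ _).inv ≫ boxInl (box f g) h)
    ((α_ _ _ _).inv ≫ boxInl f g ▷ Z₁ ≫ boxInr (box f g) h)
    (by
      rw [associator_inv_naturality_right_assoc, whisker_exchange_assoc, ← box_condition,
        ← comp_whiskerRight_assoc, boxInl_box]
      simp)

@[simp]
theorem boxInl_assocInvAux : X₁ ◁ boxInl g h ≫ boxAssocInvAux f g h =
    (α_ _ _ _).inv ≫ boxInl (box f g) h := IsPushout.inl_desc _ _ _ _

@[simp]
theorem boxInl_assocInvAux_assoc {U : C} (t : boxDom (box f g) h ⟶ U) :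
    X₁ ◁ boxInl g h ≫ boxAssocInvAux f g h ≫ t =
      (α_ _ _ _).inv ≫ boxInl (box f g) h ≫ t := by
  rw [← Category.assoc, boxInl_assocInvAux]
  simp only [Category.assoc]

@[simp]
theorem boxInr_assocInvAux : X₁ ◁ boxInr g h ≫ boxAssocInvAux f g h =
    (α_ _ _ _).inv ≫ boxInl f g ▷ Z₁ ≫ boxInr (box f g) h := IsPushout.inr_desc _ _ _ _

@[simp]
theorem boxInr_assocInvAux_assoc {U : C} (t : boxDom (box f g) h ⟶ U) :
    X₁ ◁ boxInr g h ≫ boxAssocInvAux f g h ≫ t =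
      (α_ _ _ _).inv ≫ boxInl f g ▷ Z₁ ≫ boxInr (box f g) h ≫ t := by
  rw [← Category.assoc, boxInr_assocInvAux]
  simp only [Category.assoc]

noncomputable def boxAssocInv : boxDom f (box g h) ⟶ boxDom (box f g) h :=
  boxDesc (boxAssocInvAux f g h) ((α_ _ _ _).inv ≫ boxInr f g ▷ Z₁ ≫ boxInr (box f g) h) (by
    apply whiskerLeft_boxDom_hom_ext
    · rw [whisker_exchange_assoc, boxInl_assocInvAux, ← MonoidalCategory.whiskerLeft_comp_assoc,
        boxInl_box, associator_inv_naturality_right_assoc, associator_inv_naturality_left_assoc,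
        whisker_exchange_assoc, ← box_condition, ← comp_whiskerRight_assoc, boxInr_box]
    · rw [whisker_exchange_assoc, boxInr_assocInvAux, ← MonoidalCategory.whiskerLeft_comp_assoc,
        boxInr_box, associator_inv_naturality_middle_assoc, associator_inv_naturality_left_assoc,
        ← comp_whiskerRight_assoc, ← comp_whiskerRight_assoc, box_condition])

@[simp]
theorem boxInl_assocInv : boxInl f (box g h) ≫ boxAssocInv f g h = boxAssocInvAux f g h :=
  boxInl_desc _ _ _

@[simp]
theorem boxInl_assocInv_assoc {U : C} (t : boxDom (box f g) h ⟶ U) :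
    boxInl f (box g h) ≫ boxAssocInv f g h ≫ t =
      boxAssocInvAux f g h ≫ t := by
  rw [← Category.assoc, boxInl_assocInv]

@[simp]
theorem boxInr_assocInv : boxInr f (box g h) ≫ boxAssocInv f g h =
    (α_ _ _ _).inv ≫ boxInr f g ▷ Z₁ ≫ boxInr (box f g) h := boxInr_desc _ _ _

@[simp]
theorem boxInr_assocInv_assoc {U : C} (t : boxDom (box f g) h ⟶ U) :
    boxInr f (box g h) ≫ boxAssocInv f g h ≫ t =
      (α_ _ _ _).inv ≫ boxInr f g ▷ Z₁ ≫ boxInr (box f g) h ≫ t := by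
  rw [← Category.assoc, boxInr_assocInv]
  simp only [Category.assoc]

theorem boxAssoc_hom_inv : boxAssocHom f g h ≫ boxAssocInv f g h = 𝟙 _ := by
  apply boxDom_hom_ext
  · simp
  · apply boxDom_whiskerRight_hom_ext <;> simp

theorem boxAssoc_inv_hom : boxAssocInv f g h ≫ boxAssocHom f g h = 𝟙 _ := by
  apply boxDom_hom_ext
  · apply whiskerLeft_boxDom_hom_ext <;> simp
  · simp

theorem boxAssoc_box : boxAssocHom f g h ≫ box f (box g h) =
    box (box f g) h ≫ (α_ X₁ Y₁ Z₁).hom := by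
  apply boxDom_hom_ext
  · simp [← MonoidalCategory.whiskerLeft_comp]
  · apply boxDom_whiskerRight_hom_ext
    · simp [← MonoidalCategory.whiskerLeft_comp, ← comp_whiskerRight_assoc]
    · simp [← comp_whiskerRight_assoc]
end assoc

section unit
variable [BraidedCategory C] [MonoidalClosed C] [HasInitial C]

noncomputable def initialTensor (X : C) : IsInitial ((⊥_ C) ⊗ X) :=
  IsInitial.isInitialObj (tensorRight X) _ initialIsInitial

noncomputable def tensorInitial (X : C) : IsInitial (X ⊗ (⊥_ C)) :=
  IsInitial.isInitialObj (tensorLeft X) _ initialIsInitial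

variable (f : X₀ ⟶ X₁)

noncomputable def boxLeftUnitorHom : boxDom (initial.to (𝟙_ C)) f ⟶ X₀ :=
  boxDesc (λ_ X₀).hom ((initialTensor X₁).to X₀) ((initialTensor X₀).hom_ext _ _)

noncomputable def boxRightUnitorHom : boxDom f (initial.to (𝟙_ C)) ⟶ X₀ :=
  boxDesc ((tensorInitial X₁).to X₀) (ρ_ X₀).hom ((tensorInitial X₀).hom_ext _ _)

@[simp]
theorem boxInl_leftUnitorHom :
    boxInl (initial.to (𝟙_ C)) f ≫ boxLeftUnitorHom f = (λ_ X₀).hom := boxInl_desc _ _ _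

@[simp]
theorem boxInl_leftUnitorHom_assoc {U : C} (t : X₀ ⟶ U) :
    boxInl (initial.to (𝟙_ C)) f ≫ boxLeftUnitorHom f ≫ t =
      (λ_ X₀).hom ≫ t := by
  rw [← Category.assoc, boxInl_leftUnitorHom]

@[simp]
theorem boxInr_rightUnitorHom :
    boxInr f (initial.to (𝟙_ C)) ≫ boxRightUnitorHom f = (ρ_ X₀).hom := boxInr_desc _ _ _

@[simp]
theorem boxInr_rightUnitorHom_assoc {U : C} (t : X₀ ⟶ U) :
    boxInr f (initial.to (𝟙_ C)) ≫ boxRightUnitorHom f ≫ t =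
      (ρ_ X₀).hom ≫ t := by
  rw [← Category.assoc, boxInr_rightUnitorHom]

theorem boxLeftUnitor_comm :
    boxLeftUnitorHom f ≫ f = box (initial.to (𝟙_ C)) f ≫ (λ_ X₁).hom := by
  apply boxDom_hom_ext
  · simp
  · exact (initialTensor _).hom_ext _ _

theorem boxRightUnitor_comm :
    boxRightUnitorHom f ≫ f = box f (initial.to (𝟙_ C)) ≫ (ρ_ X₁).hom := by
  apply boxDom_hom_ext
  · exact (tensorInitial _).hom_ext _ _
  · simp

end unit

variable [BraidedCategory C] [MonoidalClosed C] [HasInitial C]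

noncomputable instance pushoutProductStruct : MonoidalCategoryStruct (Arrow C) where
  tensorObj F G := Arrow.mk (box F.hom G.hom)
  whiskerLeft F _ _ b := Arrow.homMk
    (boxDomMap (𝟙 F.left) (𝟙 F.right) b.left b.right (by simp) b.w)
    (F.right ◁ b.right) ((boxDomMap_box ..).trans (by rw [id_tensorHom]; rfl))
  whiskerRight a G := Arrow.homMk
    (boxDomMap a.left a.right (𝟙 G.left) (𝟙 G.right) a.w (by simp))
    (a.right ▷ G.right) ((boxDomMap_box ..).trans (by rw [tensorHom_id]; rfl))
  tensorHom a b := Arrow.homMk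
    (boxDomMap a.left a.right b.left b.right a.w b.w)
    (a.right ⊗ₘ b.right) (boxDomMap_box ..)
  tensorUnit := Arrow.mk (initial.to (𝟙_ C))
  associator F G H := Arrow.isoMk
    ⟨boxAssocHom F.hom G.hom H.hom, boxAssocInv F.hom G.hom H.hom,
      boxAssoc_hom_inv .., boxAssoc_inv_hom ..⟩
    (α_ F.right G.right H.right) (boxAssoc_box ..)
  leftUnitor F := Arrow.isoMk
    ⟨boxLeftUnitorHom F.hom, (λ_ F.left).inv ≫ boxInl _ _,
      boxDom_hom_ext (by simp) ((initialTensor _).hom_ext _ _), by simp⟩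
    (λ_ F.right) (boxLeftUnitor_comm _)
  rightUnitor F := Arrow.isoMk
    ⟨boxRightUnitorHom F.hom, (ρ_ F.left).inv ≫ boxInr _ _,
      boxDom_hom_ext ((tensorInitial _).hom_ext _ _) (by simp), by simp⟩
    (ρ_ F.right) (boxRightUnitor_comm _)

section coherence
variable {X₀' X₁' Y₀' Y₁' Z₀' Z₁' : C} {f : X₀ ⟶ X₁} {g : Y₀ ⟶ Y₁} {h : Z₀ ⟶ Z₁} {k : W₀ ⟶ W₁}
  {f' : X₀' ⟶ X₁'} {g' : Y₀' ⟶ Y₁'} {h' : Z₀' ⟶ Z₁'}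

theorem boxAssocHom_naturality
    (a₀ : X₀ ⟶ X₀') (a₁ : X₁ ⟶ X₁') (b₀ : Y₀ ⟶ Y₀') (b₁ : Y₁ ⟶ Y₁') (c₀ : Z₀ ⟶ Z₀')
    (c₁ : Z₁ ⟶ Z₁') (ha : a₀ ≫ f' = f ≫ a₁) (hb : b₀ ≫ g' = g ≫ b₁) (hc : c₀ ≫ h' = h ≫ c₁) :
    boxDomMap (boxDomMap a₀ a₁ b₀ b₁ ha hb) (a₁ ⊗ₘ b₁) c₀ c₁ (boxDomMap_box ..) hc ≫
      boxAssocHom f' g' h' =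
    boxAssocHom f g h ≫
      boxDomMap a₀ a₁ (boxDomMap b₀ b₁ c₀ c₁ hb hc) (b₁ ⊗ₘ c₁) ha (boxDomMap_box ..) := by
  apply boxDom_hom_ext
  · simp only [boxInl_map_assoc, boxInl_assocHom, boxInl_assocHom_assoc, boxInl_map,
      associator_naturality_assoc, ← id_tensorHom, tensorHom_comp_tensorHom_assoc, Category.id_comp,
      Category.comp_id]
  · apply boxDom_whiskerRight_hom_ext
    · simp only [boxInr_map_assoc, boxInr_assocHom, boxInr_assocHom_assoc, boxInl_map,
        whiskerRight_comp_tensorHom_assoc, whiskerLeft_comp_tensorHom_assoc,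
        boxInl_assocHomAux, boxInl_assocHomAux_assoc, boxInr_map,
        comp_tensorHom_eq, tensorHom_comp_eq, Category.assoc, associator_naturality_assoc]
    · simp only [boxInr_map_assoc, boxInr_assocHom, boxInr_assocHom_assoc,
        whiskerRight_comp_tensorHom_assoc,
        boxInr_assocHomAux, boxInr_assocHomAux_assoc, boxInr_map,
        comp_tensorHom_eq, Category.assoc, associator_naturality_assoc]

theorem box_pentagon :
    boxDomMap (boxAssocHom f g h) (α_ X₁ Y₁ Z₁).hom (𝟙 W₀) (𝟙 W₁) (boxAssoc_box ..)
        (by simp : 𝟙 W₀ ≫ k = k ≫ 𝟙 W₁) ≫ boxAssocHom f (box g h) k ≫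
      boxDomMap (𝟙 X₀) (𝟙 X₁) (boxAssocHom g h k) (α_ Y₁ Z₁ W₁).hom
        (by simp : 𝟙 X₀ ≫ f = f ≫ 𝟙 X₁) (boxAssoc_box ..) =
    boxAssocHom (box f g) h k ≫ boxAssocHom f g (box h k) := by
  apply boxDom_hom_ext
  · simp only [boxInl_map_assoc, boxInl_assocHom_assoc, boxInl_assocHom, boxInl_map, id_tensorHom,
      tensorHom_id, ← MonoidalCategory.whiskerLeft_comp_assoc, Category.assoc,
      associator_naturality_right_assoc]
    simp
  · simp only [boxInr_map_assoc, boxInr_assocHom_assoc, tensorHom_id]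
    apply boxDom_whiskerRight_hom_ext
    · rw [← comp_whiskerRight_assoc, boxInl_assocHom, boxInl_assocHomAux_assoc,
        boxInl_assocHom]
      simp only [comp_whiskerRight, Category.assoc, boxInl_assocHomAux_assoc, boxInl_map,
        id_tensorHom]
      simp only [associator_naturality_middle_assoc, ← MonoidalCategory.whiskerLeft_comp_assoc,
        boxInr_assocHom, boxInl_assocHomAux]
      simp
    · apply boxDom_whiskerRight_whiskerRight_hom_ext
      · rw [← comp_whiskerRight_assoc (boxInr (box f g) h), boxInr_assocHom,
          ← comp_whiskerRight_assoc, boxInl_assocHomAux, boxInr_assocHomAux_assoc, associator_naturality_left_assoc,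
          boxInr_assocHom]
        simp only [comp_whiskerRight, Category.assoc, boxInl_assocHomAux_assoc, boxInl_map,
          id_tensorHom, boxInr_map]
        simp only [associator_naturality_middle_assoc, ← MonoidalCategory.whiskerLeft_comp_assoc,
          boxInr_assocHom, boxInr_assocHomAux]
        simp only [Category.assoc, MonoidalCategory.whiskerLeft_comp, pentagon_assoc,
          associator_naturality_left_assoc, boxInl_assocHomAux]
      · rw [← comp_whiskerRight_assoc (boxInr (box f g) h), boxInr_assocHom,
          ← comp_whiskerRight_assoc, boxInr_assocHomAux, boxInr_assocHomAux_assoc, associator_naturality_left_assoc,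
          boxInr_assocHom]
        simp only [comp_whiskerRight, Category.assoc, boxInr_assocHomAux_assoc, id_tensorHom,
          boxInr_map, pentagon_assoc, associator_naturality_left_assoc, boxInr_assocHomAux]

theorem boxDomMap_id : boxDomMap (𝟙 X₀) (𝟙 X₁) (𝟙 Y₀) (𝟙 Y₁) (by simp : 𝟙 X₀ ≫ f = f ≫ 𝟙 X₁)
    (by simp : 𝟙 Y₀ ≫ g = g ≫ 𝟙 Y₁) = 𝟙 _ := by
  apply boxDom_hom_ext <;> simp

theorem boxDomMap_comp {X₀'' X₁'' Y₀'' Y₁'' : C} {f'' : X₀'' ⟶ X₁''} {g'' : Y₀'' ⟶ Y₁''}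
    (a₀ : X₀ ⟶ X₀') (a₁ : X₁ ⟶ X₁') (b₀ : Y₀ ⟶ Y₀') (b₁ : Y₁ ⟶ Y₁')
    (a₀' : X₀' ⟶ X₀'') (a₁' : X₁' ⟶ X₁'') (b₀' : Y₀' ⟶ Y₀'') (b₁' : Y₁' ⟶ Y₁'')
    (ha : a₀ ≫ f' = f ≫ a₁) (hb : b₀ ≫ g' = g ≫ b₁)
    (ha' : a₀' ≫ f'' = f' ≫ a₁') (hb' : b₀' ≫ g'' = g' ≫ b₁') :
    boxDomMap a₀ a₁ b₀ b₁ ha hb ≫ boxDomMap a₀' a₁' b₀' b₁' ha' hb' =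
      boxDomMap (a₀ ≫ a₀') (a₁ ≫ a₁') (b₀ ≫ b₀') (b₁ ≫ b₁')
        (by rw [Category.assoc, ha', ← Category.assoc, ha, Category.assoc])
        (by rw [Category.assoc, hb', ← Category.assoc, hb, Category.assoc]) := by
  apply boxDom_hom_ext
  · simp only [boxInl_map_assoc, boxInl_map, tensorHom_comp_tensorHom_assoc]
  · simp only [boxInr_map_assoc, boxInr_map, tensorHom_comp_tensorHom_assoc]

theorem boxLeftUnitorHom_naturality (b₀ : Y₀ ⟶ Y₀') (b₁ : Y₁ ⟶ Y₁') (hb : b₀ ≫ g' = g ≫ b₁) :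
    boxDomMap (𝟙 _) (𝟙 _) b₀ b₁ (by simp) hb ≫ boxLeftUnitorHom g' = boxLeftUnitorHom g ≫ b₀ := by
  apply boxDom_hom_ext
  · simp
  · exact (initialTensor _).hom_ext _ _

theorem boxRightUnitorHom_naturality (b₀ : Y₀ ⟶ Y₀') (b₁ : Y₁ ⟶ Y₁') (hb : b₀ ≫ g' = g ≫ b₁) :
    boxDomMap b₀ b₁ (𝟙 _) (𝟙 _) hb (by simp) ≫ boxRightUnitorHom g' =
      boxRightUnitorHom g ≫ b₀ := by
  apply boxDom_hom_ext
  · exact (tensorInitial _).hom_ext _ _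
  · simp

theorem box_triangle :
    boxAssocHom f (initial.to (𝟙_ C)) g ≫
      boxDomMap (𝟙 X₀) (𝟙 X₁) (boxLeftUnitorHom g) (λ_ Y₁).hom (by simp)
        (boxLeftUnitor_comm g) =
    boxDomMap (boxRightUnitorHom f) (ρ_ X₁).hom (𝟙 Y₀) (𝟙 Y₁) (boxRightUnitor_comm f)
      (by simp) := by
  apply boxDom_hom_ext
  · simp only [boxInl_assocHom_assoc, boxInl_map, id_tensorHom,
      ← MonoidalCategory.whiskerLeft_comp_assoc, boxInl_leftUnitorHom]
    simp
  · apply boxDom_whiskerRight_hom_ext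
    · exact (IsInitial.isInitialObj (tensorRight Y₁) _ (tensorInitial X₁)).hom_ext _ _
    · simp [← comp_whiskerRight_assoc]
end coherence

/-- The push-out product monoidal structure on the arrow category. -/
noncomputable instance pushoutProductMonoidal : MonoidalCategory (Arrow C) := MonoidalCategory.ofTensorHom
  (id_tensorHom_id := fun X Y => Arrow.hom_ext _ _ boxDomMap_id (id_tensorHom_id _ _))
  (id_tensorHom := fun X _ _ b => Arrow.hom_ext _ _ rfl (id_tensorHom _ _))
  (tensorHom_id := fun a Y => Arrow.hom_ext _ _ rfl (tensorHom_id _ _))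
  (tensorHom_comp_tensorHom := fun a b c d => Arrow.hom_ext _ _ (boxDomMap_comp _ _ _ _ _ _ _ _ a.w b.w c.w d.w)
    (tensorHom_comp_tensorHom ..))
  (associator_naturality := fun a b c => Arrow.hom_ext _ _
    (boxAssocHom_naturality _ _ _ _ _ _ a.w b.w c.w)
    (associator_naturality ..))
  (leftUnitor_naturality := fun a => Arrow.hom_ext _ _ (boxLeftUnitorHom_naturality _ _ a.w)
    ((congrArg (· ≫ _) (id_tensorHom _ _)).trans (leftUnitor_naturality a.right)))
  (rightUnitor_naturality := fun a => Arrow.hom_ext _ _ (boxRightUnitorHom_naturality _ _ a.w)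
    ((congrArg (· ≫ _) (tensorHom_id _ _)).trans (rightUnitor_naturality a.right)))
  (pentagon := fun W X Y Z => Arrow.hom_ext _ _ box_pentagon
    (by
      have h := MonoidalCategory.pentagon W.right X.right Y.right Z.right
      rw [← tensorHom_id, ← id_tensorHom] at h
      exact h))
  (triangle := fun X Y => Arrow.hom_ext _ _ box_triangle
    (by
      have h := MonoidalCategory.triangle X.right Y.right
      rw [← tensorHom_id, ← id_tensorHom] at h
      exact h))

end PushoutProduct
/-! ### Replacements, homotopy kernels, cokernels and images -/

section Homotopy
variable {C : Type u} [Category.{v} C] [ModelCategory C]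

/-- A (chosen) cofibrant replacement `Q X`: the map `∅ ⟶ X` is factored as a cofibration
`∅ ⟶ Q X` followed by a trivial fibration `Q X ⟶ X`. -/
noncomputable def cofRepl (X : C) : C :=
  (MorphismProperty.factorizationData (cofibrations C) (trivialFibrations C) (initial.to X)).Z

/-- The trivial fibration `Q X ⟶ X`. -/
noncomputable def cofReplπ (X : C) : cofRepl X ⟶ X :=
  (MorphismProperty.factorizationData (cofibrations C) (trivialFibrations C) (initial.to X)).p

/-- A (chosen) fibrant replacement `R X`: the map `X ⟶ *` is factored as a trivial cofibration
`X ⟶ R X` followed by a fibration `R X ⟶ *`. -/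
noncomputable def fibRepl (X : C) : C :=
  (MorphismProperty.factorizationData (trivialCofibrations C) (fibrations C) (terminal.from X)).Z

/-- The trivial cofibration `X ⟶ R X`. -/
noncomputable def fibReplι (X : C) : X ⟶ fibRepl X :=
  (MorphismProperty.factorizationData (trivialCofibrations C) (fibrations C) (terminal.from X)).i

variable {X Y : C}

/-- The target of the cofibrant replacement of the arrow `f`. -/
noncomputable def cofArrowTgt (f : X ⟶ Y) : C :=
  (MorphismProperty.factorizationData (cofibrations C) (trivialFibrations C) (cofReplπ X ≫ f)).Z

/-- A cofibrant replacement of the arrow `f : X ⟶ Y` for the projective model structure on the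
arrow category: a cofibration with cofibrant source `Q X`, obtained by factoring `Q X ⟶ X ⟶ Y` as
a cofibration followed by a trivial fibration. -/
noncomputable def cofArrow (f : X ⟶ Y) : cofRepl X ⟶ cofArrowTgt f :=
  (MorphismProperty.factorizationData (cofibrations C) (trivialFibrations C) (cofReplπ X ≫ f)).i

/-- The trivial fibration from the target of the replacement to `Y`. -/
noncomputable def cofArrowTgtπ (f : X ⟶ Y) : cofArrowTgt f ⟶ Y :=
  (MorphismProperty.factorizationData (cofibrations C) (trivialFibrations C) (cofReplπ X ≫ f)).p

theorem cofArrow_fac (f : X ⟶ Y) : cofArrow f ≫ cofArrowTgtπ f = cofReplπ X ≫ f :=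
  (MorphismProperty.factorizationData (cofibrations C) (trivialFibrations C) (cofReplπ X ≫ f)).fac

/-- The comparison morphism in the arrow category from the cofibrant replacement to `f`. -/
noncomputable def cofArrowπ (f : X ⟶ Y) : Arrow.mk (cofArrow f) ⟶ Arrow.mk f :=
  Arrow.homMk (cofReplπ X) (cofArrowTgtπ f) (cofArrow_fac f).symm

/-- The source of the fibrant replacement of the arrow `g`. -/
noncomputable def fibArrowSrc (g : X ⟶ Y) : C :=
  (MorphismProperty.factorizationData (trivialCofibrations C) (fibrations C) (g ≫ fibReplι Y)).Z

/-- A fibrant replacement of the arrow `g : X ⟶ Y` for the injective model structure on the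
arrow category: a fibration with fibrant target `R Y`, obtained by factoring `X ⟶ Y ⟶ R Y` as a
trivial cofibration followed by a fibration. -/
noncomputable def fibArrow (g : X ⟶ Y) : fibArrowSrc g ⟶ fibRepl Y :=
  (MorphismProperty.factorizationData (trivialCofibrations C) (fibrations C) (g ≫ fibReplι Y)).p

/-- The trivial cofibration from `X` to the source of the replacement. -/
noncomputable def fibArrowSrcι (g : X ⟶ Y) : X ⟶ fibArrowSrc g :=
  (MorphismProperty.factorizationData (trivialCofibrations C) (fibrations C) (g ≫ fibReplι Y)).i

theorem fibArrow_fac (g : X ⟶ Y) : fibArrowSrcι g ≫ fibArrow g = g ≫ fibReplι Y :=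
  (MorphismProperty.factorizationData (trivialCofibrations C) (fibrations C) (g ≫ fibReplι Y)).fac

/-- The comparison morphism from `A` to the homotopy pull-back of `r : B ⟶ D` and `b : E ⟶ D`
attached to a commutative square; the homotopy pull-back is computed after replacing `D` by a
fibrant object and both legs by fibrations. -/
noncomputable def toHoPullback {A B E D : C} {t : A ⟶ B} {l : A ⟶ E} {r : B ⟶ D} {b : E ⟶ D}
    (sq : CommSq t l r b) : A ⟶ pullback (fibArrow r) (fibArrow b) :=
  pullback.lift (t ≫ fibArrowSrcι r) (l ≫ fibArrowSrcι b) (by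
    rw [Category.assoc, Category.assoc, fibArrow_fac, fibArrow_fac, ← Category.assoc,
      ← Category.assoc, sq.w])

/-- A commutative square is homotopy Cartesian. -/
def IsHoCartesian {A B E D : C} {t : A ⟶ B} {l : A ⟶ E} {r : B ⟶ D} {b : E ⟶ D}
    (sq : CommSq t l r b) : Prop :=
  WeakEquivalence (toHoPullback sq)

/-- The levelwise weak equivalences of the arrow category (these are the weak equivalences of both
the projective and the injective model structure). -/
def IsArrowWeakEquivalence {F G : Arrow C} (φ : F ⟶ G) : Prop :=
  WeakEquivalence φ.left ∧ WeakEquivalence φ.right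

section Pointed
variable [HasZeroObject C] [HasZeroMorphisms C]

open ZeroObject

/-- An object is contractible if it is weakly equivalent to the zero object. -/
def IsContractible (X : C) : Prop := WeakEquivalence (0 : X ⟶ (0 : C))

/-- The homotopy cokernel of `f`, i.e. the left derived functor of the cokernel functor. -/
noncomputable def hoCoker (f : X ⟶ Y) : C := cokernel (cofArrow f)

/-- The homotopy kernel of `g`, i.e. the right derived functor of the kernel functor. -/
noncomputable def hoKer (g : X ⟶ Y) : C := kernel (fibArrow g)

/-- The canonical morphism from (a cofibrant model of) `Y` to the homotopy cokernel of
`f : X ⟶ Y`. -/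
noncomputable def hoCok (f : X ⟶ Y) : cofArrowTgt f ⟶ hoCoker f := cokernel.π (cofArrow f)

/-- The homotopy image of `f : X ⟶ Y`: the homotopy kernel of `Y ⟶ hoCoker f`. -/
noncomputable def hoIm (f : X ⟶ Y) : C := hoKer (hoCok f)

/-- The homotopy coCartesian square with corners `X`, `Y`, `0` and the homotopy cokernel of
`f : X ⟶ Y` (with `f` replaced by a cofibration between cofibrant objects). -/
theorem hoCoker_commSq (f : X ⟶ Y) :
    CommSq (cofArrow f) (0 : cofRepl X ⟶ (0 : C)) (hoCok f) (0 : (0 : C) ⟶ hoCoker f) :=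
  ⟨by rw [zero_comp]; exact cokernel.condition _⟩

end Pointed

end Homotopy

/-! ### Homotopically idempotent Smith ideals and homotopically almost zero objects -/

/-- Compatibility of a model structure with a symmetric monoidal structure: tensoring with a
cofibrant object is a left Quillen functor (the right adjoint being the internal hom), and the unit
axiom holds. The first condition follows if tensoring with *every* object is left Quillen, and it
also follows from the push-out product axiom. The unit axiom is automatic if the unit is
cofibrant. -/
class SymmetricMonoidalModel (C : Type u) [Category.{v} C] [ModelCategory C] [MonoidalCategory C]
    [SymmetricCategory C] [MonoidalClosed C] : Prop where
  cofibration_whiskerLeft : ∀ (X : C) [IsCofibrant X] {A B : C} (i : A ⟶ B) [Cofibration i],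
    Cofibration (X ◁ i)
  weakEquivalence_whiskerLeft : ∀ (X : C) [IsCofibrant X] {A B : C} (i : A ⟶ B) [Cofibration i]
    [WeakEquivalence i], WeakEquivalence (X ◁ i)
  weakEquivalence_unit : ∀ (X : C) [IsCofibrant X], WeakEquivalence (cofReplπ (𝟙_ C) ▷ X)

section Almost
variable {C : Type u} [Category.{v} C] [ModelCategory C] [MonoidalCategory C]

/-- The derived tensor product `X ⊗ᴸ Y = Q X ⊗ Q Y`. -/
noncomputable def dTensor (X Y : C) : C := cofRepl X ⊗ cofRepl Y

/-- An object `X` is homotopically flat if the derived functor `X ⊗ᴸ (-)` preserves finite homotopy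
limits. Finite homotopy limits are generated by the homotopy terminal object, which is preserved
in the pointed closed case, and by homotopy pull-backs; and the derived functor is computed on
squares of cofibrant objects. -/
def IsHoFlat (X : C) : Prop :=
  ∀ ⦃A B E D : C⦄ [IsCofibrant A] [IsCofibrant B] [IsCofibrant E] [IsCofibrant D]
    ⦃t : A ⟶ B⦄ ⦃l : A ⟶ E⦄ ⦃r : B ⟶ D⦄ ⦃b : E ⟶ D⦄ (sq : CommSq t l r b),
    IsHoCartesian sq → IsHoCartesian (sq.map (tensorLeft (cofRepl X)))

/-- The object `Ĩ = I ⊗ᴸ I`. -/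
noncomputable def tildeIdeal (I : C) : C := dTensor I I

variable [SymmetricCategory C] [MonoidalClosed C]

/-- The homotopical form of the multiplication `μ_j : j □ j ⟶ j` of a monoid `j` in the arrow
category: the push-out product is formed after replacing `j` by a projectively cofibrant arrow. -/
noncomputable def dMul {I V : C} (j : I ⟶ V) [MonObj (Arrow.mk j)] :
    Arrow.mk (cofArrow j) ⊗ Arrow.mk (cofArrow j) ⟶ Arrow.mk j :=
  (cofArrowπ j ⊗ₘ cofArrowπ j) ≫ MonObj.mul

variable [HasZeroObject C] [HasZeroMorphisms C]

/-- A Smith ideal `j : I ⟶ V` is homotopically idempotent. (A Smith ideal is a monoid object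
`Arrow.mk j` of the arrow category with the push-out product monoidal structure.) -/
structure IsHoIdempotent {I V : C} (j : I ⟶ V) [MonObj (Arrow.mk j)] : Prop where
  /-- The homotopy coCartesian square defining the homotopy cokernel of `j` is also homotopy
  Cartesian. -/
  hoCartesian : IsHoCartesian (hoCoker_commSq j)
  /-- The multiplication `j □ j ⟶ j` is a weak equivalence in the arrow category. -/
  weakEquivalence_mul : IsArrowWeakEquivalence (dMul j)
  /-- `Ĩ = I ⊗ I` is homotopically flat. -/
  hoFlat : IsHoFlat (tildeIdeal I)

/-- The action map `μ_M : I ⊗ M ⟶ V ⊗ M ≅ M` of `j : I ⟶ V` where `V` is the unit object, as a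
morphism out of the derived tensor product. -/
noncomputable def actionMap {I : C} (j : I ⟶ 𝟙_ C) (M : C) : dTensor I M ⟶ M :=
  ((cofReplπ I ≫ j) ⊗ₘ cofReplπ M) ≫ (λ_ M).hom

/-- An object `M` is homotopically almost zero if the homotopy image of `I ⊗ M ⟶ M` is
contractible. -/
def IsHoAlmostZero {I : C} (j : I ⟶ 𝟙_ C) (M : C) : Prop :=
  IsContractible (hoIm (actionMap j M))

end Almost

end AlmostMath

namespace AlmostMath

/-! ### Gluing along cofibrations -/

section Gluing
variable {C : Type u} [Category.{v} C] [ModelCategory C]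

/-! Write `K` for the homotopy cokernel of `j`; all tensor products below are derived. Everything
rests on `I ⊗ K ≃ 0` (`isContractible_tensor_hoCoker`). The unit law of the monoid `j` forces `V ⊗ I
⟶ dom (j □ j) ⟶ I` to be a weak equivalence. Since the multiplication is one too, so is `V ⊗ I ⟶ dom
(j □ j)`. This map is a cobase change of `I ⊗ j`, hence has the same homotopy cokernel, namely `I ⊗
K`, which must therefore vanish.

For every `A` there is a cofibre sequence `I ⊗ A ⟶ A ⟶ K ⊗ A`. If `Ĩ ⊗ M ≃ I ⊗ (I ⊗ M)` is
contractible, take `A = I ⊗ M`: both outer terms vanish, so `I ⊗ M ≃ 0`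
(`isContractible_of_tensor`), and a map with contractible source has contractible homotopy image.

Conversely, the homotopy cokernel of `μ_M` is `K ⊗ M`. If the homotopy image of `μ_M` is
contractible, the square with corners `0`, `M`, `0`, `K ⊗ M` is homotopy Cartesian. Flatness keeps
it so after tensoring with `Ĩ`, and `Ĩ ⊗ K ⊗ M ≃ 0`; three corners are then contractible, hence so
is the fourth, `Ĩ ⊗ M`.

No properness is assumed, so the homotopy invariance of cofibres comes from a gluing lemma for
cofibrations with cofibrant source (`weakEquivalence_pushout_of_arrow`), proved as Ken Brown's lemma
for projective arrows. -/

theorem Cofibration.of_isPushout {A B A' B' : C} {i : A ⟶ B} {a : A ⟶ A'} {b : B ⟶ B'}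
    {i' : A' ⟶ B'} (sq : IsPushout i a b i') [Cofibration i] : Cofibration i' := by
  rw [cofibration_iff]
  exact MorphismProperty.of_isPushout sq.flip (mem_cofibrations i)

theorem WeakEquivalence.of_isPushout {A B A' B' : C} {i : A ⟶ B} {a : A ⟶ A'} {b : B ⟶ B'}
    {i' : A' ⟶ B'} (sq : IsPushout i a b i') [Cofibration i] [WeakEquivalence i] :
    WeakEquivalence i' :=
  (mem_trivialCofibrations_iff _).1
    (MorphismProperty.of_isPushout sq.flip (mem_trivialCofibrations i)) |>.2

theorem Fibration.of_isPullback {A B A' B' : C} {p : A ⟶ B} {a : A' ⟶ A} {b : B' ⟶ B}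
    {p' : A' ⟶ B'} (sq : IsPullback p' a b p) [Fibration p] : Fibration p' := by
  rw [fibration_iff]
  exact MorphismProperty.of_isPullback sq.flip (mem_fibrations p)

theorem WeakEquivalence.of_isPullback {A B A' B' : C} {p : A ⟶ B} {a : A' ⟶ A} {b : B' ⟶ B}
    {p' : A' ⟶ B'} (sq : IsPullback p' a b p) [Fibration p] [WeakEquivalence p] :
    WeakEquivalence p' :=
  (mem_trivialFibrations_iff _).1
    (MorphismProperty.of_isPullback sq.flip (mem_trivialFibrations p)) |>.2

theorem exists_isPushout {X Y Z : C} (f : X ⟶ Y) (g : X ⟶ Z) :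
    ∃ (P : C) (l : Y ⟶ P) (r : Z ⟶ P), IsPushout f g l r :=
  ⟨_, _, _, IsPushout.of_hasPushout f g⟩

theorem exists_cofibration_fac {X Y : C} (f : X ⟶ Y) :
    ∃ (Z : C) (i : X ⟶ Z) (p : Z ⟶ Y), Cofibration i ∧ WeakEquivalence p ∧ i ≫ p = f := by
  let F := MorphismProperty.factorizationData (cofibrations C) (trivialFibrations C) f
  exact ⟨F.Z, F.i, F.p, (cofibration_iff _).2 F.hi, ((mem_trivialFibrations_iff _).1 F.hp).2, F.fac⟩

/-- If `(A ⟶ B) ⟶ (Z ⟶ Y)` is a trivial cofibration for the projective model structure on arrows,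
then it induces a weak equivalence on push-outs along `Z ⟶ E`. -/
theorem weakEquivalence_pushout_of_projective {A B Z P Y E L N : C} {i : A ⟶ B} {c : A ⟶ Z}
    {p : B ⟶ P} {q : Z ⟶ P} (hP : IsPushout i c p q) {t : P ⟶ Y} [Cofibration c]
    [WeakEquivalence c] [WeakEquivalence (p ≫ t)] [Cofibration t] {e : Z ⟶ E}
    {l : B ⟶ L} {el : E ⟶ L} (hL : IsPushout i (c ≫ e) l el) {n : Y ⟶ N} {en : E ⟶ N}
    (hN : IsPushout (q ≫ t) e n en) {φ : L ⟶ N} (h₁ : l ≫ φ = p ≫ t ≫ n) (h₂ : el ≫ φ = en) :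
    WeakEquivalence φ := by
  have : WeakEquivalence p := WeakEquivalence.of_isPushout hP.flip
  have : WeakEquivalence t := weakEquivalence_of_precomp_of_fac (f := p) rfl
  have hl : i ≫ l = c ≫ e ≫ el := by rw [hL.w, Category.assoc]
  -- By pasting, `L` is also the push-out of `q` along `e`, so `φ` is a cobase change of the trivial
  -- cofibration `t`.
  have hL' : IsPushout q e (hP.desc l (e ≫ el) hl) el :=
    IsPushout.of_top (h₁₁ := i) (v₁₁ := c) (v₁₂ := p) (by simpa using hL) (by simp) hP
  have h : IsPushout t (hP.desc l (e ≫ el) hl) n φ := by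
    refine IsPushout.of_left (h₁₁ := q) (v₁₁ := e) (h₂₁ := el) (by simpa [h₂] using hN) ?_ hL'
    apply hP.hom_ext
    · simp [h₁]
    · simpa [h₂] using hN.w
  exact WeakEquivalence.of_isPushout h

/-- A levelwise weak equivalence between cofibrations with cofibrant source induces a weak
equivalence on push-outs. -/
theorem weakEquivalence_pushout_of_arrow {A B A' B' E L L' : C} [IsCofibrant A] [IsCofibrant A']
    {i : A ⟶ B} {i' : A' ⟶ B'} [Cofibration i] [Cofibration i'] {a : A ⟶ A'} {b : B ⟶ B'}
    [WeakEquivalence a] [WeakEquivalence b] (w : i ≫ b = a ≫ i') {e' : A' ⟶ E}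
    {l : B ⟶ L} {el : E ⟶ L} (hL : IsPushout i (a ≫ e') l el)
    {l' : B' ⟶ L'} {el' : E ⟶ L'} (hL' : IsPushout i' e' l' el')
    {φ : L ⟶ L'} (h₁ : l ≫ φ = b ≫ l') (h₂ : el ≫ φ = el') : WeakEquivalence φ := by
  -- The Brown factorization of `a` is extended to arrows. Its middle term is the cofibration from
  -- the middle object of `h` to `Y`, into which both `i` and `i'` map by trivial projective
  -- cofibrations.
  obtain ⟨h⟩ : Nonempty (CofibrantBrownFactorization a) := inferInstance
  obtain ⟨P₁, p₁, q₁, hP₁⟩ := exists_isPushout i h.i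
  obtain ⟨P₂, p₂, q₂, hP₂⟩ := exists_isPushout i' h.s
  obtain ⟨P, r₁, r₂, hP⟩ := exists_isPushout q₁ q₂
  have : Cofibration q₁ := Cofibration.of_isPushout hP₁
  have : Cofibration q₂ := Cofibration.of_isPushout hP₂
  have : Cofibration r₂ := Cofibration.of_isPushout hP
  have : Cofibration r₁ := Cofibration.of_isPushout hP.flip
  obtain ⟨Y, f, g, _, _, fac⟩ := exists_cofibration_fac
    (hP.desc (hP₁.desc b (h.p ≫ i') (by rw [h.fac_assoc, w]))
      (hP₂.desc (𝟙 _) (h.p ≫ i') (by simp)) (by simp))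
  have hb₁ : (p₁ ≫ r₁ ≫ f) ≫ g = b := by simp [fac]
  have hb₂ : (p₂ ≫ r₂ ≫ f) ≫ g = 𝟙 _ := by simp [fac]
  have hy : (q₁ ≫ r₁ ≫ f) ≫ g = h.p ≫ i' := by simp [fac]
  have : WeakEquivalence (p₁ ≫ r₁ ≫ f) := weakEquivalence_of_postcomp_of_fac hb₁
  have : WeakEquivalence (p₂ ≫ r₂ ≫ f) := weakEquivalence_of_postcomp_of_fac hb₂
  -- `N` is the push-out of the middle arrow, to which `L` and `L'` are compared by `φ₁` and `φ₂`.
  -- The map `ψ` below is a retraction of `φ₂`, hence a weak equivalence, and `φ` factors as `φ₁ ≫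
  -- ψ`.
  obtain ⟨N, n, en, hN⟩ := exists_isPushout (q₁ ≫ r₁ ≫ f) (h.p ≫ e')
  have hN' : IsPushout (q₂ ≫ r₂ ≫ f) (h.p ≫ e') n en := by
    rwa [← reassoc_of% hP.w]
  have hLa : IsPushout i (h.i ≫ h.p ≫ e') l el := by rwa [h.fac_assoc]
  have hLb : IsPushout i' (h.s ≫ h.p ≫ e') l' el' := by rwa [h.s_p_assoc]
  obtain ⟨φ₁, hφ₁, hφ₁'⟩ := hLa.exists_desc (p₁ ≫ (r₁ ≫ f) ≫ n) en (by
    simpa [reassoc_of% hP₁.w] using h.i ≫= hN.w)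
  obtain ⟨φ₂, hφ₂, hφ₂'⟩ := hLb.exists_desc (p₂ ≫ (r₂ ≫ f) ≫ n) en (by
    simpa [reassoc_of% hP₂.w] using h.s ≫= hN'.w)
  have : WeakEquivalence φ₁ := weakEquivalence_pushout_of_projective hP₁ hLa hN hφ₁ hφ₁'
  have : WeakEquivalence φ₂ := weakEquivalence_pushout_of_projective hP₂ hLb hN' hφ₂ hφ₂'
  obtain ⟨ψ, hψ, hψ'⟩ := hN.exists_desc (g ≫ l') el' (by
    rw [← Category.assoc, hy, Category.assoc, hL'.w, Category.assoc])
  have h₃ : φ₂ ≫ ψ = 𝟙 _ := by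
    apply hLb.hom_ext
    · simp only [Category.assoc] at hb₂
      simp [reassoc_of% hφ₂, hψ, reassoc_of% hb₂]
    · simp [reassoc_of% hφ₂', hψ']
  have : WeakEquivalence ψ := weakEquivalence_of_precomp_of_fac h₃
  have h₄ : φ₁ ≫ ψ = φ := by
    apply hLa.hom_ext
    · simp only [Category.assoc] at hb₁
      simp [reassoc_of% hφ₁, hψ, reassoc_of% hb₁, h₁]
    · simp [reassoc_of% hφ₁', hψ', h₂]
  rw [← h₄]
  infer_instance

end Gluing

/-! ### Contractible objects -/

section Contractible
variable {C : Type u} [Category.{v} C] [ModelCategory C]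

theorem isCofibrant_of_isZero {Z : C} (hZ : IsZero Z) : IsCofibrant Z := by
  rw [isCofibrant_iff_of_isInitial (𝟙 Z) hZ.isInitial]
  infer_instance

/-- Collapsing a contractible cofibrant subobject is a weak equivalence. -/
theorem weakEquivalence_of_isPushout_isZero {A B Z L : C} [IsCofibrant A] {i : A ⟶ B}
    [Cofibration i] {z : A ⟶ Z} [WeakEquivalence z] (hZ : IsZero Z) {l : B ⟶ L} {ζ : Z ⟶ L}
    (sq : IsPushout i z l ζ) : WeakEquivalence l := by
  have : IsCofibrant Z := isCofibrant_of_isZero hZ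
  have : IsCofibrant B := isCofibrant_of_cofibration i
  have : Cofibration (hZ.to_ B) := (isCofibrant_iff_of_isInitial _ hZ.isInitial).1 inferInstance
  have h : hZ.to_ A ≫ z = 𝟙 Z := hZ.eq_of_src _ _
  have : WeakEquivalence (hZ.to_ A) := weakEquivalence_of_postcomp_of_fac h
  -- The cofibration `Z ⟶ B` out of the zero object is compared with `i`; their push-outs to `Z` are
  -- `B` and `L`.
  refine weakEquivalence_pushout_of_arrow (i := hZ.to_ B) (a := hZ.to_ A) (b := 𝟙 B)
    (l := 𝟙 B) (el := hZ.to_ B) (hZ.eq_of_src _ _) ?_ sq rfl (hZ.eq_of_src _ _)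
  rw [h]
  exact IsPushout.id_vert _

/-- The kernel of a fibration between fibrant objects with contractible target is weakly equivalent
to the source. -/
theorem weakEquivalence_of_isPullback_isZero {X E Z K : C} [IsFibrant E] {p : X ⟶ E}
    [Fibration p] {z : Z ⟶ E} [WeakEquivalence z] (hZ : IsZero Z) {k : K ⟶ X} {ζ : K ⟶ Z}
    (sq : IsPullback k ζ p z) : WeakEquivalence k := by
  have : IsCofibrant (Opposite.op E) := by
    rw [isCofibrant_iff_of_isInitial (terminal.from E).op (initialOpOfTerminal terminalIsTerminal)]
    infer_instance
  rw [← weakEquivalences_op_iff]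
  exact weakEquivalence_of_isPushout_isZero hZ.op sq.op.flip

-- Tensoring turns the chosen zero object into another one; this allows a return to the chosen one.
omit [ModelCategory C] in
theorem isPushout_of_isZero {A B L Z Z' : C} {i : A ⟶ B} {z : A ⟶ Z} {l : B ⟶ L} {ζ : Z ⟶ L}
    (sq : IsPushout i z l ζ) (hZ : IsZero Z) (hZ' : IsZero Z') :
    IsPushout i (hZ'.from_ A) l (hZ'.to_ L) :=
  IsPushout.of_iso sq (Iso.refl _) (Iso.refl _) (hZ.iso hZ') (Iso.refl _) (by simp)
    (hZ'.eq_of_tgt _ _) (by simp) (hZ.eq_of_src _ _)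

variable [HasZeroObject C] [HasZeroMorphisms C]

open ZeroObject

theorem isContractible_iff_of_weakEquivalence {X Y : C} (f : X ⟶ Y) [WeakEquivalence f] :
    IsContractible X ↔ IsContractible Y := by
  have h : f ≫ (0 : Y ⟶ (0 : C)) = 0 := comp_zero
  unfold IsContractible
  exact ⟨fun _ => weakEquivalence_of_precomp_of_fac h, fun _ => by rw [← h]; infer_instance⟩

theorem isContractible_of_isZero {Z : C} (hZ : IsZero Z) : IsContractible Z := by
  have : IsIso (0 : Z ⟶ (0 : C)) := ⟨0, hZ.eq_of_src _ _, (isZero_zero C).eq_of_src _ _⟩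
  unfold IsContractible
  infer_instance

theorem isContractible_iff_of_isZero_target {X Z : C} (hZ : IsZero Z) (f : X ⟶ Z) :
    IsContractible X ↔ WeakEquivalence f := by
  have h : f ≫ (0 : Z ⟶ (0 : C)) = 0 := comp_zero
  have hZ' := isContractible_of_isZero hZ
  unfold IsContractible at hZ' ⊢
  exact ⟨fun _ => weakEquivalence_of_postcomp_of_fac h, fun _ => by rw [← h]; infer_instance⟩

theorem weakEquivalence_of_isContractible {X Y : C} (f : X ⟶ Y) (hX : IsContractible X)
    (hY : IsContractible Y) : WeakEquivalence f := by
  have h : f ≫ (0 : Y ⟶ (0 : C)) = 0 := comp_zero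
  unfold IsContractible at hX hY
  exact weakEquivalence_of_postcomp_of_fac h

theorem isPushout_cokernel {X Y : C} (f : X ⟶ Y) :
    IsPushout f (0 : X ⟶ (0 : C)) (cokernel.π f) 0 := by
  refine IsPushout.mk' (by simp) (fun T φ φ' h _ => Cofork.IsColimit.hom_ext
    (cokernelIsCokernel f) h) (fun T a b h => ⟨cokernel.desc f a ?_, cokernel.π_desc _ _ _,
      (isZero_zero C).eq_of_src _ _⟩)
  rw [h, zero_comp]

theorem isPullback_kernel {X Y : C} (f : X ⟶ Y) :
    IsPullback (kernel.ι f) (0 : kernel f ⟶ (0 : C)) f 0 := by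
  refine IsPullback.mk' (by simp) (fun T φ φ' h _ => Fork.IsLimit.hom_ext
    (kernelIsKernel f) h) (fun T a b h => ⟨kernel.lift f a ?_, kernel.lift_ι _ _ _,
      (isZero_zero C).eq_of_tgt _ _⟩)
  rw [h, comp_zero]

end Contractible

/-! ### Tensor products with cofibrant objects -/

section Tensor
variable {C : Type u} [Category.{v} C] [ModelCategory C] [MonoidalCategory C]
  [SymmetricCategory C] [MonoidalClosed C] [SymmetricMonoidalModel C]

instance cofibration_whiskerLeft (X : C) [IsCofibrant X] {A B : C} (i : A ⟶ B) [Cofibration i] :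
    Cofibration (X ◁ i) :=
  SymmetricMonoidalModel.cofibration_whiskerLeft X i

/-- Ken Brown's lemma for the tensor product with a cofibrant object. -/
instance weakEquivalence_whiskerLeft (X : C) [IsCofibrant X] {A B : C} [IsCofibrant A]
    [IsCofibrant B] (f : A ⟶ B) [WeakEquivalence f] : WeakEquivalence (X ◁ f) := by
  obtain ⟨h⟩ : Nonempty (CofibrantBrownFactorization f) := inferInstance
  have : WeakEquivalence (X ◁ h.i) := SymmetricMonoidalModel.weakEquivalence_whiskerLeft X h.i
  have : WeakEquivalence (X ◁ h.s) := SymmetricMonoidalModel.weakEquivalence_whiskerLeft X h.s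
  have : X ◁ h.s ≫ X ◁ h.p = 𝟙 _ := by simp [← MonoidalCategory.whiskerLeft_comp]
  have : WeakEquivalence (X ◁ h.p) := weakEquivalence_of_precomp_of_fac this
  rw [← h.fac, MonoidalCategory.whiskerLeft_comp]
  infer_instance

omit [ModelCategory C] [MonoidalClosed C] [SymmetricMonoidalModel C] in
theorem whiskerRight_eq_braiding {A B : C} (f : A ⟶ B) (X : C) :
    f ▷ X = (β_ A X).hom ≫ X ◁ f ≫ (β_ B X).inv := by
  simp

instance cofibration_whiskerRight (X : C) [IsCofibrant X] {A B : C} (i : A ⟶ B) [Cofibration i] :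
    Cofibration (i ▷ X) := by
  rw [whiskerRight_eq_braiding]; infer_instance

instance weakEquivalence_whiskerRight (X : C) [IsCofibrant X] {A B : C} [IsCofibrant A]
    [IsCofibrant B] (f : A ⟶ B) [WeakEquivalence f] : WeakEquivalence (f ▷ X) := by
  rw [whiskerRight_eq_braiding]; infer_instance

instance isCofibrant_tensor (X Y : C) [IsCofibrant X] [IsCofibrant Y] : IsCofibrant (X ⊗ Y) :=
  (isCofibrant_iff_of_isInitial (X ◁ initial.to Y) (tensorInitial X)).2 inferInstance

variable [HasZeroObject C] [HasZeroMorphisms C]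

open ZeroObject

omit [ModelCategory C] [SymmetricCategory C] [SymmetricMonoidalModel C] [HasZeroMorphisms C] in
theorem isZero_tensor (X : C) {Z : C} (hZ : IsZero Z) : IsZero (X ⊗ Z) :=
  (isZero_zero C).of_iso ((IsInitial.isInitialObj (tensorLeft X) Z hZ.isInitial).uniqueUpToIso
    (isZero_zero C).isInitial)

omit [ModelCategory C] [SymmetricMonoidalModel C] [HasZeroMorphisms C] in
theorem isZero_tensor_left (X : C) {Z : C} (hZ : IsZero Z) : IsZero (Z ⊗ X) :=
  (isZero_tensor X hZ).of_iso (β_ Z X)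

theorem IsContractible.tensor {Y : C} (hY : IsContractible Y) (X : C) [IsCofibrant X]
    [IsCofibrant Y] : IsContractible (X ⊗ Y) := by
  have : IsCofibrant (0 : C) := isCofibrant_of_isZero (isZero_zero C)
  unfold IsContractible at hY
  rw [isContractible_iff_of_isZero_target (isZero_tensor X (isZero_zero C)) (X ◁ 0)]
  infer_instance

theorem IsContractible.tensor_left {Y : C} (hY : IsContractible Y) (X : C) [IsCofibrant X]
    [IsCofibrant Y] : IsContractible (Y ⊗ X) :=
  (isContractible_iff_of_weakEquivalence (β_ Y X).hom).2 (hY.tensor X)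

end Tensor

/-! ### Properties of the chosen replacements -/

section Replacements
variable {C : Type u} [Category.{v} C] [ModelCategory C] {X Y : C}

instance isCofibrant_cofRepl : IsCofibrant (cofRepl X) := by
  let F := MorphismProperty.factorizationData (cofibrations C) (trivialFibrations C) (initial.to X)
  have : Cofibration F.i := (cofibration_iff _).2 F.hi
  exact (isCofibrant_iff_of_isInitial F.i initialIsInitial).2 this

instance fibration_cofReplπ : Fibration (cofReplπ X) :=
  ((mem_trivialFibrations_iff _).1 (MorphismProperty.MapFactorizationData.hp _)).1

instance weakEquivalence_cofReplπ : WeakEquivalence (cofReplπ X) :=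
  ((mem_trivialFibrations_iff _).1 (MorphismProperty.MapFactorizationData.hp _)).2

instance isFibrant_fibRepl : IsFibrant (fibRepl X) := by
  let F := MorphismProperty.factorizationData (trivialCofibrations C) (fibrations C)
    (terminal.from X)
  have : Fibration F.p := (fibration_iff _).2 F.hp
  exact (isFibrant_iff_of_isTerminal F.p terminalIsTerminal).2 this

instance weakEquivalence_fibReplι : WeakEquivalence (fibReplι X) :=
  ((mem_trivialCofibrations_iff _).1 (MorphismProperty.MapFactorizationData.hi _)).2

variable (f : X ⟶ Y)

instance cofibration_cofArrow : Cofibration (cofArrow f) :=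
  (cofibration_iff _).2 (MorphismProperty.MapFactorizationData.hi _)

instance fibration_cofArrowTgtπ : Fibration (cofArrowTgtπ f) :=
  ((mem_trivialFibrations_iff _).1 (MorphismProperty.MapFactorizationData.hp _)).1

instance weakEquivalence_cofArrowTgtπ : WeakEquivalence (cofArrowTgtπ f) :=
  ((mem_trivialFibrations_iff _).1 (MorphismProperty.MapFactorizationData.hp _)).2

instance isCofibrant_cofArrowTgt : IsCofibrant (cofArrowTgt f) :=
  isCofibrant_of_cofibration (cofArrow f)

instance fibration_fibArrow : Fibration (fibArrow f) :=
  (fibration_iff _).2 (MorphismProperty.MapFactorizationData.hp _)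

instance weakEquivalence_fibArrowSrcι : WeakEquivalence (fibArrowSrcι f) :=
  ((mem_trivialCofibrations_iff _).1 (MorphismProperty.MapFactorizationData.hi _)).2

instance isFibrant_fibArrowSrc : IsFibrant (fibArrowSrc f) :=
  isFibrant_of_fibration (fibArrow f)

instance weakEquivalence_fibArrow [WeakEquivalence f] : WeakEquivalence (fibArrow f) := by
  have : WeakEquivalence (fibArrowSrcι f ≫ fibArrow f) := by
    rw [fibArrow_fac]; infer_instance
  exact weakEquivalence_of_precomp (fibArrowSrcι f) _

/-- Two cofibrant approximations of an object are related by a weak equivalence. -/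
theorem exists_weakEquivalence_lift {A B D : C} [IsCofibrant A] (p : B ⟶ D) [Fibration p]
    [WeakEquivalence p] (f : A ⟶ D) [WeakEquivalence f] :
    ∃ g : A ⟶ B, g ≫ p = f ∧ WeakEquivalence g := by
  have sq : CommSq (initial.to B) (initial.to A) p f := ⟨Subsingleton.elim _ _⟩
  exact ⟨sq.lift, sq.fac_right, weakEquivalence_of_postcomp_of_fac sq.fac_right⟩

variable [HasZeroObject C] [HasZeroMorphisms C]

open ZeroObject

theorem isPushout_hoCok :
    IsPushout (cofArrow f) (0 : cofRepl X ⟶ (0 : C)) (hoCok f) 0 :=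
  isPushout_cokernel _

instance isCofibrant_hoCoker : IsCofibrant (hoCoker f) := by
  have : Cofibration (0 : 0 ⟶ hoCoker f) := Cofibration.of_isPushout (isPushout_hoCok f)
  exact (isCofibrant_iff_of_isInitial _ (isZero_zero C).isInitial).2 this

/-- If the source of `f` is contractible, then so is the homotopy image of `f`. -/
theorem isContractible_hoIm (h : IsContractible X) : IsContractible (hoIm f) := by
  have : WeakEquivalence (0 : cofRepl X ⟶ (0 : C)) :=
    (isContractible_iff_of_weakEquivalence (cofReplπ X)).2 h
  -- Since `hoCok f` is a weak equivalence, its fibrant replacement is a trivial fibration, and the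
  -- kernel of that is a pull-back of it over `0`.
  have : WeakEquivalence (hoCok f) :=
    weakEquivalence_of_isPushout_isZero (isZero_zero C) (isPushout_hoCok f)
  exact WeakEquivalence.of_isPullback (isPullback_kernel (fibArrow (hoCok f))).flip

/-- The square with corners `Z`, `Y`, `Z'`, `D`, with `Z` and `Z'` zero objects, is homotopy
Cartesian if the homotopy kernel of `Y ⟶ D` is contractible. -/
theorem isHoCartesian_of_isContractible_hoKer {Z Z' Y D : C} {t : Z ⟶ Y} {l : Z ⟶ Z'} {r : Y ⟶ D}
    {b : Z' ⟶ D} (sq : CommSq t l r b) (hZ : IsZero Z) (hZ' : IsZero Z')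
    (h : IsContractible (hoKer r)) : IsHoCartesian sq := by
  have hP : IsPullback (pullback.fst (fibArrow r) (fibArrow b)) (pullback.snd _ _) (fibArrow r)
    (fibArrow b) := .of_hasPullback _ _
  have := Fibration.of_isPullback hP.flip
  have hK : (0 : (0 : C) ⟶ fibArrowSrc b) ≫ fibArrow b = 0 := zero_comp
  have : WeakEquivalence (0 : (0 : C) ⟶ fibArrowSrc b) :=
    weakEquivalence_of_isContractible _ (isContractible_of_isZero (isZero_zero C))
      ((isContractible_iff_of_weakEquivalence (fibArrowSrcι b)).1 (isContractible_of_isZero hZ'))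
  -- The homotopy pull-back is fibred over the contractible fibrant object `fibArrowSrc b`. By
  -- pasting, the kernel of this fibration is `hoKer r`, so its inclusion `k` is a weak equivalence.
  obtain ⟨k, hk₁, hk₂⟩ := hP.exists_lift (kernel.ι (fibArrow r)) 0 (by simp)
  have hk : IsPullback k (0 : kernel (fibArrow r) ⟶ (0 : C))
      (pullback.snd (fibArrow r) (fibArrow b)) 0 := by
    refine IsPullback.of_right (h₁₂ := pullback.fst _ _) (h₂₂ := fibArrow b) (v₁₃ := fibArrow r)
      ?_ (by simpa using hk₂) hP
    rw [hK, hk₁]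
    exact isPullback_kernel _
  have := weakEquivalence_of_isPullback_isZero (isZero_zero C) hk
  exact weakEquivalence_of_isContractible _ (isContractible_of_isZero hZ)
    ((isContractible_iff_of_weakEquivalence k).1 h)

/-- In a homotopy Cartesian square with three contractible corners, the remaining corner
is contractible. -/
theorem isContractible_of_isHoCartesian {A B E D : C} {t : A ⟶ B} {l : A ⟶ E} {r : B ⟶ D}
    {b : E ⟶ D} {sq : CommSq t l r b} (h : IsHoCartesian sq) (hA : IsContractible A)
    (hE : IsContractible E) (hD : IsContractible D) : IsContractible B := by
  have hP : IsPullback (pullback.fst (fibArrow r) (fibArrow b)) (pullback.snd _ _) (fibArrow r)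
    (fibArrow b) := .of_hasPullback _ _
  -- A map between contractible objects is a weak equivalence, so `fibArrow b` is a trivial
  -- fibration and the homotopy pull-back is equivalent to `B`.
  have := weakEquivalence_of_isContractible b hE hD
  have := WeakEquivalence.of_isPullback hP
  unfold IsHoCartesian at h
  rw [isContractible_iff_of_weakEquivalence (fibArrowSrcι r),
    ← isContractible_iff_of_weakEquivalence (pullback.fst (fibArrow r) (fibArrow b)),
    ← isContractible_iff_of_weakEquivalence (toHoPullback sq)]
  exact hA

end Replacements

/-! ### The Smith ideal -/

section Monoid
variable {C : Type u} [Category.{v} C] [MonoidalCategory C]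

/-- The hypothesis gives a one-sided inverse of `η`, which is two-sided because endomorphisms of the
unit object commute. -/
theorem isIso_of_whiskerRight_comp_eq_leftUnitor {η : 𝟙_ C ⟶ 𝟙_ C} {m : 𝟙_ C ⊗ 𝟙_ C ⟶ 𝟙_ C}
    (h : η ▷ 𝟙_ C ≫ m = (λ_ _).hom) : IsIso η := by
  have h₁ : η ≫ (ρ_ _).inv ≫ m = 𝟙 _ := by
    rw [rightUnitor_inv_naturality_assoc, h, unitors_equal, Iso.inv_hom_id]
  have comm (a b : 𝟙_ C ⟶ 𝟙_ C) : a ≫ b = b ≫ a := by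
    simpa [unitors_equal, unitors_inv_equal] using (whisker_exchange a b).symm
  exact ⟨_, h₁, by rw [comm, h₁]⟩

variable [BraidedCategory C] [MonoidalClosed C] [HasPushouts C] [HasInitial C]

/-- A Smith ideal `j : I ⟶ 𝟙` acts on `I` by an isomorphism `𝟙 ⊗ I ⟶ I`. -/
theorem isIso_boxInl_mul {I : C} (j : I ⟶ 𝟙_ C) [MonObj (Arrow.mk j)] :
    IsIso (boxInl j j ≫ (MonObj.mul : Arrow.mk j ⊗ Arrow.mk j ⟶ Arrow.mk j).left) := by
  have h := MonObj.one_mul (Arrow.mk j)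
  -- The monoid structure on the target `𝟙_ C` may have a unit other than the identity; the right
  -- component of the unit law shows that it is at least invertible.
  have h₁ : (MonObj.one : 𝟙_ (Arrow C) ⟶ Arrow.mk j).right ▷ 𝟙_ C ≫
      (MonObj.mul : Arrow.mk j ⊗ Arrow.mk j ⟶ Arrow.mk j).right = (λ_ (𝟙_ C)).hom :=
    congrArg CommaMorphism.right h
  have : IsIso (MonObj.one : 𝟙_ (Arrow C) ⟶ Arrow.mk j).right :=
    isIso_of_whiskerRight_comp_eq_leftUnitor h₁
  have h₂ : (MonObj.one : 𝟙_ (Arrow C) ⟶ Arrow.mk j).right ▷ I ≫ boxInl j j ≫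
      -- The left component of the unit law is restricted to the summand `𝟙 ⊗ I`.
      (MonObj.mul : Arrow.mk j ⊗ Arrow.mk j ⟶ Arrow.mk j).left = (λ_ I).hom := by
    have := congrArg (boxInl (initial.to (𝟙_ C)) j ≫ ·) (congrArg CommaMorphism.left h)
    refine Eq.trans ?_ (this.trans (boxInl_leftUnitorHom j))
    rw [← tensorHom_id]
    exact (boxInl_map_assoc (f := initial.to (𝟙_ C)) (g := j) (f' := j) (g' := j) _ _ _ _
      (MonObj.one : 𝟙_ (Arrow C) ⟶ Arrow.mk j).w (by simp) _).symm
  exact IsIso.of_isIso_fac_left h₂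

end Monoid

/-! ### The homotopy cokernel of an idempotent Smith ideal -/

section SmithIdeal
variable {C : Type u} [Category.{v} C] [ModelCategory C] [MonoidalCategory C]
  [SymmetricCategory C] [MonoidalClosed C] [SymmetricMonoidalModel C]

/-- The unit axiom holds for any cofibrant approximation of the unit. -/
theorem weakEquivalence_whiskerRight_unit {W : C} [IsCofibrant W] (w : W ⟶ 𝟙_ C) [Fibration w]
    [WeakEquivalence w] (X : C) [IsCofibrant X] : WeakEquivalence (w ▷ X) := by
  -- The unit axiom concerns the chosen replacement of `𝟙_ C`, whereas `cofArrowTgt j` is a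
  -- different one; `g` compares the two.
  obtain ⟨g, hg, _⟩ := exists_weakEquivalence_lift w (cofReplπ (𝟙_ C))
  have := SymmetricMonoidalModel.weakEquivalence_unit X
  have h : g ▷ X ≫ w ▷ X = cofReplπ (𝟙_ C) ▷ X := by rw [← comp_whiskerRight, hg]
  exact weakEquivalence_of_precomp_of_fac h

variable {I : C} (j : I ⟶ 𝟙_ C)

/-- Two out of three: followed by the derived multiplication, this map becomes the derived action of
`V` on `I`, which is a weak equivalence by the unit axiom and `isIso_boxInl_mul`. -/
theorem weakEquivalence_boxInl_cofArrow [MonObj (Arrow.mk j)]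
    (h : IsArrowWeakEquivalence (dMul j)) :
    WeakEquivalence (boxInl (cofArrow j) (cofArrow j)) := by
  have := isIso_boxInl_mul j
  have := weakEquivalence_whiskerRight_unit (cofArrowTgtπ j) (cofRepl I)
  -- Neither `𝟙_ C` nor `I` need be cofibrant, so Ken Brown's lemma is replaced by the unitor.
  have h₁ : 𝟙_ C ◁ cofReplπ I = (λ_ _).hom ≫ cofReplπ I ≫ (λ_ _).inv := by simp
  have : WeakEquivalence (𝟙_ C ◁ cofReplπ I) := by rw [h₁]; infer_instance
  have h₂ : boxInl (cofArrow j) (cofArrow j) ≫ (dMul j).left =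
      (cofArrowTgtπ j ▷ cofRepl I ≫ 𝟙_ C ◁ cofReplπ I) ≫
        boxInl j j ≫ (MonObj.mul : Arrow.mk j ⊗ Arrow.mk j ⟶ Arrow.mk j).left := by
    rw [← MonoidalCategory.tensorHom_def]
    exact boxInl_map_assoc (f := cofArrow j) (g := cofArrow j) (f' := j) (g' := j) _ _ _ _
      (cofArrowπ j).w (cofArrowπ j).w _
  have := h.1
  exact weakEquivalence_of_postcomp_of_fac h₂

variable [HasZeroObject C] [HasZeroMorphisms C]

open ZeroObject

/-- The map `boxInl` is a cobase change of `cofRepl I ◁ cofArrow j`, so both have cokernel `cofRepl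
I ⊗ hoCoker j`. As `boxInl` is a trivial cofibration, so is the map from zero to that cokernel. -/
theorem isContractible_tensor_hoCoker [MonObj (Arrow.mk j)]
    (h : IsArrowWeakEquivalence (dMul j)) : IsContractible (cofRepl I ⊗ hoCoker j) := by
  have := weakEquivalence_boxInl_cofArrow j h
  have hbox := box_isPushout (cofArrow j) (cofArrow j)
  have : Cofibration (boxInl (cofArrow j) (cofArrow j)) := Cofibration.of_isPushout hbox.flip
  have hZ := isZero_tensor (cofRepl I) (isZero_zero C)
  have hK : IsPushout (cofRepl I ◁ cofArrow j) (cofArrow j ▷ cofRepl I ≫ hZ.from_ _)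
      (cofRepl I ◁ hoCok j) (cofRepl I ◁ (0 : 0 ⟶ hoCoker j)) := by
    rw [hZ.eq_of_tgt (_ ≫ hZ.from_ _) (cofRepl I ◁ (0 : cofRepl I ⟶ (0 : C)))]
    exact (isPushout_hoCok j).map (tensorLeft (cofRepl I))
  obtain ⟨c, hc₁, hc₂⟩ := hbox.flip.exists_desc (cofRepl I ◁ hoCok j)
    (hZ.from_ _ ≫ cofRepl I ◁ (0 : 0 ⟶ hoCoker j)) (by rw [hK.w, Category.assoc])
  -- The square `hK` is the pasting of the push-out product square with this one, which is thus a
  -- push-out.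
  have hc : IsPushout (boxInl (cofArrow j) (cofArrow j)) (hZ.from_ _) c
      (cofRepl I ◁ (0 : 0 ⟶ hoCoker j)) :=
    IsPushout.of_top (h₁₁ := cofRepl I ◁ cofArrow j) (by rwa [hc₁]) hc₂ hbox.flip
  have := WeakEquivalence.of_isPushout hc
  exact (isContractible_iff_of_weakEquivalence (cofRepl I ◁ (0 : 0 ⟶ hoCoker j))).1
    (isContractible_of_isZero hZ)

omit [SymmetricMonoidalModel C] in
/-- Tensoring the homotopy cofibre sequence of `j` with a cofibrant object `A`. -/
theorem isPushout_hoCok_whiskerRight (A : C) :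
    IsPushout (cofArrow j ▷ A) ((0 : cofRepl I ⟶ (0 : C)) ▷ A) (hoCok j ▷ A)
      ((0 : 0 ⟶ hoCoker j) ▷ A) :=
  (isPushout_hoCok j).map (tensorRight A)

/-- In the cofibre sequence `I ⊗ A ⟶ A ⟶ K ⊗ A`, collapsing the contractible first term makes the
second map a weak equivalence. -/
theorem isContractible_of_tensor {A : C} [IsCofibrant A] (h : IsContractible (cofRepl I ⊗ A))
    (hK : IsContractible (hoCoker j ⊗ A)) : IsContractible A := by
  have hZ := isZero_tensor_left A (isZero_zero C)
  have : WeakEquivalence ((0 : cofRepl I ⟶ (0 : C)) ▷ A) :=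
    (isContractible_iff_of_isZero_target hZ _).1 h
  have := weakEquivalence_of_isPushout_isZero hZ (isPushout_hoCok_whiskerRight j A)
  have := weakEquivalence_whiskerRight_unit (cofArrowTgtπ j) A
  rw [← isContractible_iff_of_weakEquivalence (λ_ A).hom,
    ← isContractible_iff_of_weakEquivalence (cofArrowTgtπ j ▷ A),
    isContractible_iff_of_weakEquivalence (hoCok j ▷ A)]
  exact hK

instance isCofibrant_dTensor (X Y : C) : IsCofibrant (dTensor X Y) :=
  isCofibrant_tensor _ _

omit [SymmetricCategory C] [MonoidalClosed C] [SymmetricMonoidalModel C] [HasZeroObject C]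
  [HasZeroMorphisms C] in
theorem cofArrow_whiskerRight_comp (M : C) :
    cofArrow j ▷ cofRepl M ≫ cofArrowTgtπ j ▷ cofRepl M ≫ (λ_ (cofRepl M)).hom ≫ cofReplπ M =
      actionMap j M := by
  have h : ((cofReplπ I ≫ j) ⊗ₘ cofReplπ M) ≫ (λ_ M).hom =
      (cofReplπ I ≫ j) ▷ cofRepl M ≫ (λ_ (cofRepl M)).hom ≫ cofReplπ M := by
    rw [MonoidalCategory.tensorHom_def, Category.assoc, leftUnitor_naturality]
  rw [← comp_whiskerRight_assoc, cofArrow_fac]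
  exact h.symm

/-- The homotopy cokernel of the action map is the tensor product with the homotopy cokernel
of `j`. -/
theorem exists_weakEquivalence_hoCoker_actionMap (M : C) :
    ∃ φ : hoCoker j ⊗ cofRepl M ⟶ hoCoker (actionMap j M), WeakEquivalence φ := by
  have := weakEquivalence_whiskerRight_unit (cofArrowTgtπ j) (cofRepl M)
  -- The derived tensor product is already cofibrant, so its replacement map has a section `s`.
  obtain ⟨s, hs, _⟩ : ∃ s : cofRepl I ⊗ cofRepl M ⟶ cofRepl (dTensor I M),
      s ≫ cofReplπ (dTensor I M) = 𝟙 _ ∧ WeakEquivalence s :=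
    exists_weakEquivalence_lift (cofReplπ (dTensor I M)) (𝟙 (dTensor I M))
  let b : cofArrowTgt j ⊗ cofRepl M ⟶ M :=
    cofArrowTgtπ j ▷ cofRepl M ≫ (λ_ (cofRepl M)).hom ≫ cofReplπ M
  have : WeakEquivalence b := by unfold b; infer_instance
  -- The lift of this square, together with `s`, is a levelwise equivalence between two cofibrations
  -- modelling `μ_M`; the gluing lemma then compares their cokernels.
  have sq : CommSq (s ≫ cofArrow (actionMap j M)) (cofArrow j ▷ cofRepl M)
      (cofArrowTgtπ (actionMap j M)) b := ⟨by
    rw [Category.assoc, cofArrow_fac, reassoc_of% hs, cofArrow_whiskerRight_comp]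
    exact Category.id_comp _⟩
  have : WeakEquivalence sq.lift := weakEquivalence_of_postcomp_of_fac sq.fac_right
  have hL := isPushout_of_isZero (isPushout_hoCok_whiskerRight j (cofRepl M))
    (isZero_tensor_left _ (isZero_zero C)) (isZero_zero C)
  have hL' := isPushout_hoCok (actionMap j M)
  rw [(isZero_zero C).eq_of_tgt ((isZero_zero C).from_ _)
    (s ≫ (0 : cofRepl (dTensor I M) ⟶ (0 : C)))] at hL
  obtain ⟨φ, h₁, h₂⟩ := hL.exists_desc (sq.lift ≫ hoCok (actionMap j M)) 0 (by
    rw [sq.fac_left_assoc, Category.assoc, hL'.w, Category.assoc])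
  exact ⟨φ, weakEquivalence_pushout_of_arrow sq.fac_left hL hL' h₁ h₂⟩

/-! ### The two implications -/

variable {j}

theorem isContractible_tensor_tensor (hK : IsContractible (cofRepl I ⊗ hoCoker j)) (A : C)
    [IsCofibrant A] : IsContractible (cofRepl I ⊗ hoCoker j ⊗ A) :=
  (isContractible_iff_of_weakEquivalence (α_ _ _ _).hom).1 (hK.tensor_left A)

theorem isContractible_tensor_tensor' (hK : IsContractible (cofRepl I ⊗ hoCoker j)) (A : C)
    [IsCofibrant A] : IsContractible (hoCoker j ⊗ cofRepl I ⊗ A) :=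
  (isContractible_iff_of_weakEquivalence ((β_ _ _).hom ▷ A ≫ (α_ _ _ _).hom)).1
    (hK.tensor_left A)

/-- The outer cofibrant replacement is redundant, because `cofRepl I ⊗ cofRepl I` is already
cofibrant. -/
theorem isContractible_tildeIdeal_tensor_iff (A : C) [IsCofibrant A] :
    IsContractible (cofRepl (tildeIdeal I) ⊗ A) ↔ IsContractible (cofRepl I ⊗ cofRepl I ⊗ A) := by
  have : IsCofibrant (tildeIdeal I) := isCofibrant_dTensor _ _
  rw [isContractible_iff_of_weakEquivalence (cofReplπ (tildeIdeal I) ▷ A),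
    ← isContractible_iff_of_weakEquivalence (α_ (cofRepl I) (cofRepl I) A).hom]
  rfl

/-- The cofibre sequence is applied with `A = cofRepl I ⊗ cofRepl M`, the source of the action map.
-/
theorem isHoAlmostZero_of_isContractible (hK : IsContractible (cofRepl I ⊗ hoCoker j)) (M : C)
    (h : IsContractible (dTensor (tildeIdeal I) M)) : IsHoAlmostZero j M :=
  isContractible_hoIm _ (isContractible_of_tensor j
    ((isContractible_tildeIdeal_tensor_iff _).1 h) (isContractible_tensor_tensor' hK _))

theorem isContractible_of_isHoAlmostZero (hK : IsContractible (cofRepl I ⊗ hoCoker j))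
    (hI : IsHoFlat (tildeIdeal I)) (M : C) (h : IsHoAlmostZero j M) :
    IsContractible (dTensor (tildeIdeal I) M) := by
  have : IsCofibrant (0 : C) := isCofibrant_of_isZero (isZero_zero C)
  -- Contractibility of the homotopy image makes this square homotopy Cartesian; its corners are
  -- cofibrant, as `IsHoFlat` requires.
  have sq : CommSq (0 : 0 ⟶ cofArrowTgt (actionMap j M)) (0 : (0 : C) ⟶ 0)
    (hoCok (actionMap j M)) 0 := ⟨by simp⟩
  have h₀ : IsContractible (cofRepl (tildeIdeal I) ⊗ (0 : C)) :=
    isContractible_of_isZero (isZero_tensor _ (isZero_zero C))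
  obtain ⟨φ, _⟩ := exists_weakEquivalence_hoCoker_actionMap j M
  have hL : IsContractible (cofRepl (tildeIdeal I) ⊗ hoCoker (actionMap j M)) := by
    rw [← isContractible_iff_of_weakEquivalence (_ ◁ φ), isContractible_tildeIdeal_tensor_iff]
    exact (isContractible_tensor_tensor hK _).tensor _
  -- The square involves `cofArrowTgt (actionMap j M)`, the goal `cofRepl M`; `g` compares these two
  -- cofibrant models of `M`.
  obtain ⟨g, -, _⟩ := exists_weakEquivalence_lift (cofArrowTgtπ (actionMap j M)) (cofReplπ M)
  refine (isContractible_iff_of_weakEquivalence (cofRepl (tildeIdeal I) ◁ g)).2 ?_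
  exact isContractible_of_isHoCartesian
    (hI sq (isHoCartesian_of_isContractible_hoKer sq (isZero_zero C) (isZero_zero C) h)) h₀ h₀ hL

end SmithIdeal

end AlmostMath

theorem lemma3p6 {C : Type u} [Category.{v} C] [ModelCategory C] [HasZeroObject C]
    [HasZeroMorphisms C] [MonoidalCategory C] [SymmetricCategory C] [MonoidalClosed C]
    [AlmostMath.SymmetricMonoidalModel C] {I : C} (j : I ⟶ 𝟙_ C) [MonObj (Arrow.mk j)]
    (hj : AlmostMath.IsHoIdempotent j) (M : C) :
    AlmostMath.IsHoAlmostZero j M ↔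
      AlmostMath.IsContractible (AlmostMath.dTensor (AlmostMath.tildeIdeal I) M) := by
  have hK := AlmostMath.isContractible_tensor_hoCoker j hj.weakEquivalence_mul
  exact ⟨AlmostMath.isContractible_of_isHoAlmostZero hK hj.hoFlat M,
    AlmostMath.isHoAlmostZero_of_isContractible hK M⟩
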